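/- Let $n,T$ be nonnegative integers. For $t=1,\dots,T$ let $L_t:\mathbb R^n\times\mathbb R^n\to\mathbb R\cup\{+\infty\}$ be proper, convex and lower semicontinuous, and let $g:\mathbb R^n\to\mathbb R\cup\{+\infty\}$ be proper, convex and lower semicontinuous. Write $\Delta x_t=x_t-x_{t-1}$, and let $\varphi^*(y)=\sup_{x\in\mathbb R^n}\{x\cdot y-\varphi(x)\}$ denote the conjugate and $\operatorname{dom}(\varphi)=\{x:\varphi(x)<+\infty\}$ the effective domain of $\varphi:\mathbb R^n\to\mathbb R\cup\{\pm\infty\}$. Put $$K_t(p,w)=\sup_{x,v\in\mathbb R^n}\{x\cdot w+v\cdot p-L_t(x,v)\},\qquad f(b)=g^*(-b),$$ and, for $\tau\in\{0,\dots,T\}$ and $\xi,\eta\in\mathbb R^n$, define the primal and dual value functions $$\vartheta_\tau(\xi)=\inf\Big\{\sum_{t=\tau+1}^T L_t(x_{t-1},\Delta x_t)+g(x_T)\ \Big|\ x_\tau,\dots,x_T\in\mathbb R^n,\ x_\tau=\xi\Big\},$$ $$\omega_\tau(\eta)=\inf\Big\{\sum_{t=\tau+1}^T K_t(p_t,\Delta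 p_t)+f(p_T)\ \Big|\ p_\tau,\dots,p_T\in\mathbb R^n,\ p_\tau=-\eta\Big\}$$ (so that $\vartheta_T(\xi)=g(\xi)$ and $\omega_T(\eta)=f(-\eta)$). Let $\Gamma_L(t,x)=\{v\in\mathbb R^n: L_t(x,v)\in\mathbb R\}$ and $X(t)=\{x\in\mathbb R^n:\Gamma_L(t,x)\ne\emptyset\}$, let $\operatorname{ri}$ denote the relative interior, and assume (H) there are $\bar x_0,\dots,\bar x_T\in\mathbb R^n$ such that $\bar x_T\in\operatorname{ri}(\operatorname{dom}(g))$ and, for every $t\in\{1,\dots,T\}$, $\bar x_{t-1}\in\operatorname{ri}(X(t))$ and $\Delta\bar x_t\in\operatorname{ri}(\Gamma_L(t,\bar x_{t-1}))$. Then for every $\tau\in\{0,\dots,T\}$ one has $\vartheta_\tau^*=\omega_\tau$ on $\mathbb R^n$. Moreover, for every $\eta\in\operatorname{dom}(\omega_\tau)$ the infimum defining $\omega_\tau(\eta)$ is attained. -/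

import Mathlib

namespace Bolza

noncomputable section

/-- The state space `ℝⁿ` with its Euclidean structure. -/
abbrev Vec (n : ℕ) : Type := EuclideanSpace ℝ (Fin n)

/-- Effective domain of an extended-real-valued function. -/
def effDom {X : Type*} (φ : X → EReal) : Set X := {x | φ x < ⊤}

/-- Epigraph, as a subset of `X × ℝ`. -/
def epi {X : Type*} (φ : X → EReal) : Set (X × ℝ) := {q | φ q.1 ≤ (q.2 : EReal)}

/-- Proper: somewhere less than `+∞`, nowhere `-∞`. -/
def IsProper {X : Type*} (φ : X → EReal) : Prop := (effDom φ).Nonempty ∧ ∀ x, ⊥ < φ x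

/-- Proper, convex (convex epigraph) and lower semicontinuous. -/
structure IsProperConvexLsc {X : Type*} [AddCommGroup X] [Module ℝ X] [TopologicalSpace X]
    (φ : X → EReal) : Prop where
  proper : IsProper φ
  convex : Convex ℝ (epi φ)
  lsc : LowerSemicontinuous φ

/-- Convex conjugate on `ℝⁿ`. -/
def conjugate {n : ℕ} (φ : Vec n → EReal) (y : Vec n) : EReal :=
  ⨆ x : Vec n, ((inner ℝ x y : ℝ) : EReal) - φ x

/-- The dual Lagrangian `K_t(p, w) = sup_{x,v} { x·w + v·p - L_t(x, v) }`. -/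
def dualLagrangian {n : ℕ} (L : ℕ → Vec n × Vec n → EReal) (t : ℕ) (q : Vec n × Vec n) : EReal :=
  ⨆ z : Vec n × Vec n, ((inner ℝ z.1 q.2 + inner ℝ z.2 q.1 : ℝ) : EReal) - L t z

/-- The dual terminal cost `f(b) = g*(-b)`. -/
def dualTerminal {n : ℕ} (g : Vec n → EReal) (b : Vec n) : EReal := conjugate g (-b)

/-- The primal cost `∑_{t=τ+1}^T L_t(x_{t-1}, x_t - x_{t-1}) + g(x_T)`. A trajectory is given
as a sequence on `ℕ`, of which only the entries with indices in `[τ, T]` are used. -/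
def primalCost {n : ℕ} (T : ℕ) (L : ℕ → Vec n × Vec n → EReal) (g : Vec n → EReal)
    (τ : ℕ) (x : ℕ → Vec n) : EReal :=
  (∑ t ∈ Finset.Icc (τ + 1) T, L t (x (t - 1), x t - x (t - 1))) + g (x T)

/-- The dual cost `∑_{t=τ+1}^T K_t(p_t, p_t - p_{t-1}) + f(p_T)`. -/
def dualCost {n : ℕ} (T : ℕ) (L : ℕ → Vec n × Vec n → EReal) (g : Vec n → EReal)
    (τ : ℕ) (p : ℕ → Vec n) : EReal :=
  (∑ t ∈ Finset.Icc (τ + 1) T, dualLagrangian L t (p t, p t - p (t - 1))) +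
    dualTerminal g (p T)

/-- The primal value function `ϑ_τ`, for `τ ≤ T`. -/
def primalValue {n : ℕ} (T : ℕ) (L : ℕ → Vec n × Vec n → EReal) (g : Vec n → EReal)
    (τ : ℕ) (ξ : Vec n) : EReal :=
  ⨅ (x : ℕ → Vec n) (_ : x τ = ξ), primalCost T L g τ x

/-- The dual value function `ω_τ`, for `τ ≤ T`. -/
def dualValue {n : ℕ} (T : ℕ) (L : ℕ → Vec n × Vec n → EReal) (g : Vec n → EReal)
    (τ : ℕ) (η : Vec n) : EReal :=
  ⨅ (p : ℕ → Vec n) (_ : p τ = -η), dualCost T L g τ p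

/-- At the final time the primal value function is the terminal cost `g`. -/
theorem primalValue_final {n : ℕ} (T : ℕ) (L : ℕ → Vec n × Vec n → EReal) (g : Vec n → EReal)
    (ξ : Vec n) : primalValue T L g T ξ = g ξ := by
  apply le_antisymm
  · refine iInf₂_le_of_le (fun _ => ξ) rfl ?_
    simp [primalCost]
  · refine le_iInf₂ fun x hx => ?_
    simp [primalCost, hx]

/-- At the final time the dual value function is `η ↦ f(-η)`. -/
theorem dualValue_final {n : ℕ} (T : ℕ) (L : ℕ → Vec n × Vec n → EReal) (g : Vec n → EReal)
    (η : Vec n) : dualValue T L g T η = dualTerminal g (-η) := by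
  apply le_antisymm
  · refine iInf₂_le_of_le (fun _ => -η) rfl ?_
    simp [dualCost]
  · refine le_iInf₂ fun p hp => ?_
    simp [dualCost, hp]

/-- `Γ_L(t, x) = {v | L_t(x, v) ∈ ℝ}`. -/
def dynamicsSet {n : ℕ} (L : ℕ → Vec n × Vec n → EReal) (t : ℕ) (x : Vec n) : Set (Vec n) :=
  {v | ∃ r : ℝ, L t (x, v) = (r : EReal)}

/-- `X(t) = {x | Γ_L(t, x) ≠ ∅}`. -/
def stateSet {n : ℕ} (L : ℕ → Vec n × Vec n → EReal) (t : ℕ) : Set (Vec n) :=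
  {x | (dynamicsSet L t x).Nonempty}

/-- The strict feasibility (qualification) condition on the primal problem. -/
def PrimalStrictlyFeasible {n : ℕ} (T : ℕ) (L : ℕ → Vec n × Vec n → EReal)
    (g : Vec n → EReal) : Prop :=
  ∃ x : ℕ → Vec n, x T ∈ intrinsicInterior ℝ (effDom g) ∧
    ∀ t ∈ Finset.Icc 1 T, x (t - 1) ∈ intrinsicInterior ℝ (stateSet L t) ∧
      x t - x (t - 1) ∈ intrinsicInterior ℝ (dynamicsSet L t (x (t - 1)))

end

end Bolza

/-!
Put `E_τ := {(x_τ, r) | the cost of the trajectory x from τ to T is at most r}`. Then `E_T = epi g`,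
and `E_{t-1}` is obtained from `epi L_t` and `E_t` by one dynamic programming step. Because
`dualCost` is itself a primal cost, with running cost `(π, w) ↦ K_t(π + w, w)` and terminal cost
`f`, the corresponding sets of the dual problem obey the same recursion. Fenchel–Rockafellar duality
says that dualizing commutes with one step, so induction on `T - τ` identifies the epigraph of
`p ↦ ϑ_τ^*(-p)` with the dual set at `τ`; as membership in the latter is witnessed by a trajectory,
attainment comes for free. The constraint qualification enters Fenchel–Rockafellar duality through
prolongation of segments, and in this form it is stable under the operations building `E_τ`.
Working with `E_τ` rather than with `epi ϑ_τ` avoids the sums `⊤ + ⊥` that would appear in a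
recursion for `ϑ_τ`, which may take the value `-∞`.
-/

open Filter Topology
open scoped Pointwise

namespace Bolza

section RelativeCore

variable {V W : Type*} [AddCommGroup V] [Module ℝ V] [AddCommGroup W] [Module ℝ W]

/-- The algebraic relative interior: every segment of `C` ending at `x` can be prolonged beyond `x`
inside `C`. Asking this for all small `ε > 0`, rather than for some `ε > 0`, makes no difference
when `C` is convex, and makes the notion stable under intersections without convexity. -/
def relCore (C : Set V) : Set V :=
  {x | x ∈ C ∧ ∀ y ∈ C, ∀ᶠ ε in 𝓝[>] (0 : ℝ), x + ε • (x - y) ∈ C}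

theorem intrinsicInterior_subset_relCore {E : Type*} [NormedAddCommGroup E] [NormedSpace ℝ E]
    (C : Set E) : intrinsicInterior ℝ C ⊆ relCore C := by
  intro x hx
  refine ⟨intrinsicInterior_subset hx, fun y hy => ?_⟩
  obtain ⟨x, hint, rfl⟩ := mem_intrinsicInterior.1 hx
  have mem_span (ε : ℝ) : (x : E) + ε • ((x : E) - y) ∈ affineSpan ℝ C := by
    have := AffineMap.lineMap_mem (-ε) x.2 (subset_affineSpan ℝ C hy)
    rw [AffineMap.lineMap_apply_module'] at this
    convert this using 1
    module
  let line (ε : ℝ) : affineSpan ℝ C := ⟨(x : E) + ε • ((x : E) - y), mem_span ε⟩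
  have line_zero : line 0 = x := by ext; simp [line]
  have line_cont : Continuous line := Continuous.subtype_mk (by fun_prop) _
  have near : ∀ᶠ ε in 𝓝 (0 : ℝ), line ε ∈ ((↑) ⁻¹' C : Set (affineSpan ℝ C)) :=
    line_cont.continuousAt.eventually (line_zero ▸ mem_interior_iff_mem_nhds.1 hint)
  exact near.filter_mono nhdsWithin_le_nhds

theorem exists_prolong_of_mem_relCore {C : Set V} {x y : V} (hx : x ∈ relCore C) (hy : y ∈ C) :
    ∃ ε : ℝ, 0 < ε ∧ x + ε • (x - y) ∈ C :=
  (eventually_mem_nhdsWithin.and (hx.2 y hy)).exists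

theorem mem_relCore_of_forall_exists_prolong {C : Set V} (hC : Convex ℝ C) {x : V} (hx : x ∈ C)
    (h : ∀ y ∈ C, ∃ ε : ℝ, 0 < ε ∧ x + ε • (x - y) ∈ C) : x ∈ relCore C := by
  refine ⟨hx, fun y hy => ?_⟩
  obtain ⟨ε, hε, hmem⟩ := h y hy
  filter_upwards [Ioc_mem_nhdsGT hε] with δ ⟨hδ, hδε⟩
  have := hC.add_smul_sub_mem hx hmem (t := δ / ε) ⟨by positivity, (div_le_one hε).2 hδε⟩
  rwa [add_sub_cancel_left, smul_smul, div_mul_cancel₀ _ hε.ne'] at this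

theorem relCore_inter_subset (C D : Set V) : relCore C ∩ relCore D ⊆ relCore (C ∩ D) :=
  fun _ ⟨hC, hD⟩ => ⟨⟨hC.1, hD.1⟩, fun y hy => (hC.2 y hy.1).and (hD.2 y hy.2)⟩

theorem preimage_relCore_subset (f : V →ₗ[ℝ] W) (D : Set W) :
    f ⁻¹' relCore D ⊆ relCore (f ⁻¹' D) :=
  fun _ hx => ⟨hx.1, fun y hy => (hx.2 (f y) hy).mono fun ε hε => by simpa using hε⟩

theorem image_relCore_subset (f : V →ₗ[ℝ] W) (C : Set V) : f '' relCore C ⊆ relCore (f '' C) := by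
  rintro _ ⟨x, hx, rfl⟩
  refine ⟨⟨x, hx.1, rfl⟩, ?_⟩
  rintro _ ⟨y, hy, rfl⟩
  exact (hx.2 y hy).mono fun ε hε => ⟨_, hε, by simp⟩

theorem relCore_prod_subset (C : Set V) (D : Set W) :
    relCore C ×ˢ relCore D ⊆ relCore (C ×ˢ D) :=
  fun _ hx => relCore_inter_subset _ _
    ⟨preimage_relCore_subset (LinearMap.fst ℝ V W) C hx.1,
      preimage_relCore_subset (LinearMap.snd ℝ V W) D hx.2⟩

theorem prodMk_mem_relCore {D : Set (V × W)} (hD : Convex ℝ D) {x : V} {v : W}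
    (hx : x ∈ relCore (Prod.fst '' D)) (hv : v ∈ relCore {w | (x, w) ∈ D}) :
    (x, v) ∈ relCore D := by
  refine mem_relCore_of_forall_exists_prolong hD hv.1 ?_
  rintro ⟨y, w⟩ hyw
  obtain ⟨ε, hε, ⟨x', v'⟩, hx'v', rfl : x' = x + ε • (x - y)⟩ :=
    exists_prolong_of_mem_relCore hx ⟨_, hyw, rfl⟩
  set v₁ : W := (ε / (1 + ε)) • w + (1 / (1 + ε)) • v' with hv₁
  have hxv₁ : (x, v₁) ∈ D := by
    convert hD hyw hx'v' (a := ε / (1 + ε)) (b := 1 / (1 + ε)) (by positivity) (by positivity)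
      (by field_simp; ring) using 1
    refine Prod.ext ?_ hv₁
    simp only [Prod.fst_add, Prod.smul_fst]
    match_scalars
    all_goals field_simp
    all_goals ring
  obtain ⟨δ, hδ, hxv₂ : (x, v + δ • (v - v₁)) ∈ D⟩ := exists_prolong_of_mem_relCore hv hxv₁
  -- `(x, v)` is a convex combination, with positive weights, of `(y, w)` and the two points
  -- `(x', v')` and `(x, v + δ • (v - v₁))` of `D`.
  refine ⟨δ * ε / (1 + δ + ε), by positivity, ?_⟩
  convert hD hxv₂ hx'v' (a := (1 + ε) / (1 + δ + ε)) (b := δ / (1 + δ + ε)) (by positivity)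
    (by positivity) (by field_simp; ring) using 1
  ext1 <;> simp only [Prod.fst_add, Prod.snd_add, Prod.smul_fst, Prod.smul_snd, Prod.fst_sub,
    Prod.snd_sub, hv₁] <;> match_scalars
  all_goals field_simp
  all_goals ring

end RelativeCore

section Multipliers

variable {V X Y : Type*} [AddCommGroup V] [Module ℝ V] [AddCommGroup X] [Module ℝ X]
  [AddCommGroup Y] [Module ℝ Y]

theorem exists_mem_smul_of_mem_hull {S : Set V} (hS : Convex ℝ S) (hne : S.Nonempty) {x : V}
    (hx : x ∈ PointedCone.hull ℝ S) : ∃ c : ℝ, 0 ≤ c ∧ x ∈ c • S := by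
  induction hx using Submodule.span_induction with
  | mem x hx => exact ⟨1, zero_le_one, by rwa [one_smul]⟩
  | zero => exact ⟨0, le_rfl, by rw [Set.zero_smul_set hne]; rfl⟩
  | add x y _ _ hx hy =>
    obtain ⟨⟨c, hc, hx⟩, ⟨d, hd, hy⟩⟩ := And.intro hx hy
    exact ⟨c + d, add_nonneg hc hd, hS.add_smul hc hd ▸ Set.add_mem_add hx hy⟩
  | smul a x _ hx =>
    obtain ⟨c, hc, y, hy, rfl⟩ := hx
    exact ⟨a * c, mul_nonneg a.2 hc, y, hy, mul_smul (a : ℝ) c y⟩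

theorem exists_mem_smul_of_mem_span {D : Set V} (hD : Convex ℝ D) (h0 : (0 : V) ∈ relCore D)
    {u : V} (hu : u ∈ Submodule.span ℝ D) : ∃ c : ℝ, 0 < c ∧ u ∈ c • D := by
  induction hu using Submodule.span_induction with
  | mem u hu => exact ⟨1, one_pos, by rwa [one_smul]⟩
  | zero => exact ⟨1, one_pos, by rw [one_smul]; exact h0.1⟩
  | add u v _ _ hu hv =>
    obtain ⟨⟨c, hc, hu⟩, ⟨d, hd, hv⟩⟩ := And.intro hu hv
    exact ⟨c + d, add_pos hc hd, hD.add_smul hc.le hd.le ▸ Set.add_mem_add hu hv⟩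
  | smul a u _ hu =>
    obtain ⟨c, hc, y, hy, rfl⟩ := hu
    rcases lt_trichotomy a 0 with ha | rfl | ha
    · obtain ⟨ε, hε, hneg⟩ := exists_prolong_of_mem_relCore h0 hy
      refine ⟨-a * c / ε, div_pos (mul_pos (neg_pos.2 ha) hc) hε, _, hneg, ?_⟩
      match_scalars
      field_simp
    · exact ⟨1, one_pos, by rw [zero_smul, one_smul]; exact h0.1⟩
    · exact ⟨a * c, mul_pos ha hc, y, hy, mul_smul a c y⟩

theorem exists_linear_minorant_of_absorbing {C : Set (V × ℝ)} (hC : Convex ℝ C)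
    (habs : ∀ u, ∃ c : ℝ, 0 < c ∧ u ∈ c • (Prod.fst '' C)) (h0 : ∀ r, ((0 : V), r) ∈ C → 0 ≤ r) :
    ∃ p : V →ₗ[ℝ] ℝ, ∀ z ∈ C, p z.1 ≤ z.2 := by
  have hne : C.Nonempty := by
    obtain ⟨c, -, -, ⟨z, hz, -⟩, -⟩ := habs 0
    exact ⟨z, hz⟩
  let height : (V × ℝ) →ₗ.[ℝ] ℝ :=
    ⟨Submodule.prod ⊥ ⊤, (LinearMap.snd ℝ V ℝ).comp (Submodule.subtype _)⟩
  have height_nonneg (x : height.domain) (hx : (x : V × ℝ) ∈ PointedCone.hull ℝ C) :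
      0 ≤ height x := by
    obtain ⟨⟨u, r⟩, hu : u = 0, _⟩ := x
    subst hu
    obtain ⟨c, hc, ⟨w, s⟩, hws, hcw⟩ := exists_mem_smul_of_mem_hull hC hne hx
    obtain ⟨hw : c • w = 0, hs : c * s = r⟩ := Prod.mk.inj hcw
    change 0 ≤ r
    rcases smul_eq_zero.1 hw with rfl | rfl
    · exact (hs.symm.trans (zero_mul s)).ge
    · exact hs ▸ mul_nonneg hc (h0 s hws)
  have height_dense (y : V × ℝ) :
      ∃ x : height.domain, (x : V × ℝ) + y ∈ PointedCone.hull ℝ C := by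
    obtain ⟨u, r⟩ := y
    obtain ⟨c, hc, _, ⟨z, hz, rfl⟩, rfl⟩ := habs u
    refine ⟨⟨(0, c * z.2 - r), rfl, trivial⟩, ?_⟩
    convert PointedCone.smul_mem _ hc.le (PointedCone.subset_hull hz) using 1
    ext1 <;> simp
  obtain ⟨φ, hφ, hφC⟩ := riesz_extension _ height height_nonneg height_dense
  refine ⟨-φ.comp (LinearMap.inl ℝ V ℝ), fun z hz => ?_⟩
  have vertical : φ (0, z.2) = z.2 := hφ ⟨(0, z.2), rfl, trivial⟩
  have split : φ z = φ (z.1, 0) + φ (0, z.2) := by simp [← map_add]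
  have nonneg : 0 ≤ φ z := hφC z (PointedCone.subset_hull hz)
  simp only [LinearMap.neg_apply, LinearMap.comp_apply, LinearMap.inl_apply]
  linarith

theorem exists_affine_minorant_of_zero_mem_relCore {C : Set (V × ℝ)} (hC : Convex ℝ C)
    (h0 : (0 : V) ∈ relCore (Prod.fst '' C)) {m : ℝ} (hm : ∀ r, ((0 : V), r) ∈ C → m ≤ r) :
    ∃ p : V →ₗ[ℝ] ℝ, ∀ z ∈ C, m + p z.1 ≤ z.2 := by
  have hD : Convex ℝ (Prod.fst '' C) := hC.linear_image (LinearMap.fst ℝ V ℝ)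
  let U := Submodule.span ℝ (Prod.fst '' C)
  let S : Set (U × ℝ) := {q | ((q.1 : V), m + q.2) ∈ C}
  have hS : Convex ℝ S := by
    have S_eq : S = U.subtype.prodMap LinearMap.id ⁻¹' ((fun z => (0, m) + z) ⁻¹' C) := by
      ext q
      simp [S]
    rw [S_eq]
    exact (hC.translate_preimage_right (0, m)).linear_preimage _
  have S_absorbing (w : U) : ∃ c : ℝ, 0 < c ∧ w ∈ c • (Prod.fst '' S) := by
    obtain ⟨c, hc, _, ⟨z, hz, rfl⟩, hzw⟩ := exists_mem_smul_of_mem_span hD h0 w.2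
    have hzU : z.1 ∈ U := Submodule.subset_span ⟨z, hz, rfl⟩
    exact ⟨c, hc, ⟨z.1, hzU⟩, ⟨(⟨z.1, hzU⟩, z.2 - m), by simpa [S] using hz, rfl⟩, Subtype.ext hzw⟩
  obtain ⟨p, hp⟩ := exists_linear_minorant_of_absorbing hS S_absorbing fun r hr => by
    linarith [hm _ hr]
  obtain ⟨P, hP⟩ := p.exists_extend
  refine ⟨P, fun z hz => ?_⟩
  have hzU : z.1 ∈ U := Submodule.subset_span ⟨z, hz, rfl⟩
  have hPz : P z.1 = p ⟨z.1, hzU⟩ := LinearMap.congr_fun hP ⟨z.1, hzU⟩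
  linarith [hp (⟨z.1, hzU⟩, z.2 - m) (by simpa [S] using hz)]

theorem zero_mem_relCore_image_sub (f : X →ₗ[ℝ] Y) {C : Set X} {D : Set Y} {x : X}
    (hC : x ∈ relCore C) (hD : f x ∈ relCore D) :
    (0 : Y) ∈ relCore ((fun z : X × Y => z.2 - f z.1) '' (C ×ˢ D)) :=
  image_relCore_subset (LinearMap.snd ℝ X Y - f.comp (LinearMap.fst ℝ X Y)) _
    ⟨(x, f x), relCore_prod_subset _ _ ⟨hC, hD⟩, sub_self (f x)⟩

theorem exists_fenchel_rockafellar_multiplier {A : Set (X × ℝ)} {B : Set (Y × ℝ)}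
    (hA : Convex ℝ A) (hB : Convex ℝ B) (f : X →ₗ[ℝ] Y) (ℓ : X →ₗ[ℝ] ℝ) {x : X}
    (hxA : x ∈ relCore (Prod.fst '' A)) (hxB : f x ∈ relCore (Prod.fst '' B)) {M : ℝ}
    (hM : ∀ a ∈ A, ∀ b ∈ B, b.1 = f a.1 → ℓ a.1 - a.2 - b.2 ≤ M) :
    ∃ (q : Y →ₗ[ℝ] ℝ) (s t : ℝ), (∀ a ∈ A, ℓ a.1 - q (f a.1) - a.2 ≤ s) ∧
      (∀ b ∈ B, q b.1 - b.2 ≤ t) ∧ s + t = M := by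
  -- The value, as a function of `u`, of the problem perturbed to `b.1 - f a.1 = u`.
  let Φ : (X × ℝ) × (Y × ℝ) →ₗ[ℝ] Y × ℝ :=
    ((LinearMap.fst ℝ Y ℝ).comp (LinearMap.snd ℝ _ _) -
      f.comp ((LinearMap.fst ℝ X ℝ).comp (LinearMap.fst ℝ _ _))).prod
    ((LinearMap.snd ℝ X ℝ).comp (LinearMap.fst ℝ _ _) +
      (LinearMap.snd ℝ Y ℝ).comp (LinearMap.snd ℝ _ _) -
      ℓ.comp ((LinearMap.fst ℝ X ℝ).comp (LinearMap.fst ℝ _ _)))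
  have hΦ (a : X × ℝ) (b : Y × ℝ) : Φ (a, b) = (b.1 - f a.1, a.2 + b.2 - ℓ a.1) := rfl
  have h0 : (0 : Y) ∈ relCore (Prod.fst '' (Φ '' (A ×ˢ B))) := by
    have := zero_mem_relCore_image_sub f hxA hxB
    rw [Set.prod_image_image_eq, Set.image_image] at this
    rwa [Set.image_image]
  obtain ⟨q, hq⟩ := exists_affine_minorant_of_zero_mem_relCore ((hA.prod hB).linear_image Φ) h0
    (m := -M) (by
      rintro r ⟨⟨a, b⟩, ⟨ha, hb⟩, hab⟩
      obtain ⟨hfeas, rfl⟩ := Prod.mk.inj ((hΦ a b).symm.trans hab)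
      linarith [hM a ha b hb (sub_eq_zero.1 hfeas)])
  have separated (a) (ha : a ∈ A) (b) (hb : b ∈ B) :
      ℓ a.1 - q (f a.1) - a.2 ≤ M - (q b.1 - b.2) := by
    have := hq _ ⟨(a, b), ⟨ha, hb⟩, rfl⟩
    rw [hΦ, map_sub] at this
    linarith
  obtain ⟨⟨a₀, ha₀, -⟩, -⟩ := hxA
  obtain ⟨⟨b₀, hb₀, -⟩, -⟩ := hxB
  obtain ⟨s, hsA, hsB⟩ := exists_between_of_forall_le (Set.Nonempty.image _ ⟨a₀, ha₀⟩)
    (Set.Nonempty.image _ ⟨b₀, hb₀⟩) (Set.forall_mem_image.2 fun a ha =>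
      Set.forall_mem_image.2 fun b hb => separated a ha b hb)
  exact ⟨q, s, M - s, fun a ha => hsA ⟨a, ha, rfl⟩, fun b hb => by linarith [hsB ⟨b, hb, rfl⟩],
    add_sub_cancel s M⟩

end Multipliers

section BellmanStep

/-- One backward step of dynamic programming on epigraphs: if `A` describes the running cost of a
state and an increment, and `B` the cost-to-go after the step, this set describes the cost-to-go
before the step. No infimum over the increment is taken, so that the points of the set record that
their height is an upper bound of the cost of an actual choice. -/
def bellmanStep {E : Type*} [Add E] (A : Set ((E × E) × ℝ)) (B : Set (E × ℝ)) : Set (E × ℝ) :=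
  {q | ∃ (v : E) (s t : ℝ), ((q.1, v), s) ∈ A ∧ (q.1 + v, t) ∈ B ∧ s + t = q.2}

theorem image_fst_bellmanStep {E : Type*} [Add E] (A : Set ((E × E) × ℝ)) (B : Set (E × ℝ)) :
    Prod.fst '' bellmanStep A B =
      Prod.fst '' (Prod.fst '' A ∩ {z : E × E | z.1 + z.2 ∈ Prod.fst '' B}) := by
  ext x
  constructor
  · rintro ⟨⟨x, _⟩, ⟨v, s, t, hs, ht, -⟩, rfl⟩
    exact ⟨(x, v), ⟨⟨_, hs, rfl⟩, ⟨_, ht, rfl⟩⟩, rfl⟩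
  · rintro ⟨⟨x, v⟩, ⟨⟨⟨_, s⟩, hs, rfl⟩, ⟨⟨_, t⟩, ht, rfl⟩⟩, rfl⟩
    exact ⟨(x, s + t), ⟨v, s, t, hs, ht, rfl⟩, rfl⟩

variable {E : Type*} [AddCommGroup E] [Module ℝ E]

theorem convex_bellmanStep {A : Set ((E × E) × ℝ)} {B : Set (E × ℝ)} (hA : Convex ℝ A)
    (hB : Convex ℝ B) : Convex ℝ (bellmanStep A B) := by
  rintro ⟨x, _⟩ ⟨v, s, t, hs, ht, rfl⟩ ⟨y, _⟩ ⟨w, s', t', hs', ht', rfl⟩ a b ha hb hab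
  refine ⟨a • v + b • w, a * s + b * s', a * t + b * t', hA hs hs' ha hb hab, ?_, ?_⟩
  · convert hB ht ht' ha hb hab using 1
    ext1
    · simp only [Prod.fst_add, Prod.smul_fst]
      module
    · simp
  · simp only [Prod.snd_add, Prod.smul_snd, smul_eq_mul]
    ring

theorem mem_relCore_image_fst_bellmanStep {A : Set ((E × E) × ℝ)} {B : Set (E × ℝ)} {z : E × E}
    (hzA : z ∈ relCore (Prod.fst '' A)) (hzB : z.1 + z.2 ∈ relCore (Prod.fst '' B)) :
    z.1 ∈ relCore (Prod.fst '' bellmanStep A B) := by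
  rw [image_fst_bellmanStep]
  exact image_relCore_subset (LinearMap.fst ℝ E E) _ ⟨z, relCore_inter_subset _ _
    ⟨hzA, preimage_relCore_subset (LinearMap.fst ℝ E E + LinearMap.snd ℝ E E) _ hzB⟩, rfl⟩

end BellmanStep

section StepDuality

variable {E : Type*} [NormedAddCommGroup E] [InnerProductSpace ℝ E]

/-- The operation on epigraphs underlying `dualTerminal`: if `B` is the epigraph of `φ`, this is
the epigraph of `p ↦ φ^*(-p)`. -/
def terminalDual (B : Set (E × ℝ)) : Set (E × ℝ) :=
  {q | ∀ b ∈ B, inner ℝ b.1 (-q.1) - b.2 ≤ q.2}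

/-- The operation on epigraphs underlying `dualLagrangian`: if `A` is the epigraph of a Lagrangian
with dual `K`, this is the epigraph of `(π, w) ↦ K (π + w, w)`. The dual Lagrangian is expressed in
terms of the costate `π` before the step, since this makes the dual problem one of the same form as
the primal problem. -/
def lagrangianDual (A : Set ((E × E) × ℝ)) : Set ((E × E) × ℝ) :=
  {q | ∀ a ∈ A, inner ℝ a.1.1 q.1.2 + inner ℝ a.1.2 (q.1.1 + q.1.2) - a.2 ≤ q.2}

theorem bellmanStep_dual_subset (A : Set ((E × E) × ℝ)) (B : Set (E × ℝ)) :
    bellmanStep (lagrangianDual A) (terminalDual B) ⊆ terminalDual (bellmanStep A B) := by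
  rintro ⟨p, _⟩ ⟨w, s, t, hs, ht, rfl⟩ ⟨x, _⟩ ⟨v, r, r', hr, hr', rfl⟩
  have running := hs _ hr
  have terminal := ht _ hr'
  simp only [inner_add_left, inner_add_right, inner_neg_right] at running terminal ⊢
  linarith

theorem terminalDual_bellmanStep [FiniteDimensional ℝ E] {A : Set ((E × E) × ℝ)}
    {B : Set (E × ℝ)} (hA : Convex ℝ A) (hB : Convex ℝ B) {z : E × E}
    (hzA : z ∈ relCore (Prod.fst '' A)) (hzB : z.1 + z.2 ∈ relCore (Prod.fst '' B)) :
    terminalDual (bellmanStep A B) = bellmanStep (lagrangianDual A) (terminalDual B) := by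
  refine Set.Subset.antisymm ?_ (bellmanStep_dual_subset A B)
  rintro ⟨p, M⟩ hpM
  obtain ⟨q, s, t, hs, ht, hst⟩ := exists_fenchel_rockafellar_multiplier hA hB
    (LinearMap.fst ℝ E E + LinearMap.snd ℝ E E)
    ((innerₗ E (-p)).comp (LinearMap.fst ℝ E E)) hzA hzB (M := M) (by
      rintro ⟨⟨x, v⟩, r⟩ ha ⟨_, r'⟩ hb rfl
      have := hpM (x, r + r') ⟨v, r, r', ha, hb, rfl⟩
      simp only [LinearMap.comp_apply, LinearMap.fst_apply, innerₗ_apply_apply] at this ⊢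
      rw [real_inner_comm]
      linarith)
  obtain ⟨y, hy⟩ : ∃ y : E, ∀ u, q u = inner ℝ u y := by
    refine ⟨(InnerProductSpace.toDual ℝ E).symm (LinearMap.toContinuousLinearMap q), fun u => ?_⟩
    rw [real_inner_comm, InnerProductSpace.toDual_symm_apply, LinearMap.coe_toContinuousLinearMap']
  refine ⟨-y - p, s, t, fun a ha => ?_, fun b hb => ?_, hst⟩
  · have := hs a ha
    simp only [hy, LinearMap.comp_apply, LinearMap.add_apply, LinearMap.fst_apply,
      LinearMap.snd_apply, innerₗ_apply_apply, real_inner_comm a.1.1, inner_add_left,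
      inner_neg_right] at this
    simp only [add_sub_cancel, inner_sub_right, inner_neg_right]
    linarith
  · simpa [hy] using ht b hb

end StepDuality

section Epigraphs

variable {X : Type*}

theorem image_fst_epi (φ : X → EReal) : Prod.fst '' epi φ = effDom φ := by
  ext x
  constructor
  · rintro ⟨⟨x, r⟩, hr, rfl⟩
    exact lt_of_le_of_lt hr (EReal.coe_lt_top r)
  · intro hx
    exact ⟨(x, (φ x).toReal), EReal.le_coe_toReal hx.ne, rfl⟩

theorem iSup_coe_sub_le_coe_iff (c : X → ℝ) (φ : X → EReal) (M : ℝ) :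
    ⨆ x, (c x : EReal) - φ x ≤ M ↔ ∀ q ∈ epi φ, c q.1 - q.2 ≤ M := by
  have coe_sub_le_coe_iff (a : ℝ) (e : EReal) :
      (a : EReal) - e ≤ M ↔ ∀ r : ℝ, e ≤ r → a - r ≤ M := by
    induction e with
    | bot =>
      simp only [EReal.coe_sub_bot, top_le_iff, EReal.coe_ne_top, bot_le, true_imp_iff, false_iff]
      exact fun h => by linarith [h (a - M - 1)]
    | top => simp
    | coe s =>
      rw [← EReal.coe_sub, EReal.coe_le_coe_iff]
      exact ⟨fun h r hr => by linarith [EReal.coe_le_coe_iff.1 hr], fun h => h s le_rfl⟩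
  simp only [iSup_le_iff, coe_sub_le_coe_iff, Prod.forall]
  rfl

theorem bot_lt_iSup_coe_sub {φ : X → EReal} (hφ : (effDom φ).Nonempty) (c : X → ℝ) :
    ⊥ < ⨆ x, (c x : EReal) - φ x := by
  obtain ⟨x, hx⟩ := hφ
  refine lt_of_lt_of_le ?_ (le_iSup (fun x => (c x : EReal) - φ x) x)
  rw [sub_eq_add_neg, EReal.bot_lt_add_iff]
  exact ⟨EReal.bot_lt_coe _, bot_lt_iff_ne_bot.2 fun h => hx.ne (EReal.neg_eq_bot_iff.1 h)⟩

theorem add_le_coe_iff_exists {a b : EReal} (ha : ⊥ < a) (hb : ⊥ < b) {r : ℝ} :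
    a + b ≤ r ↔ ∃ s t : ℝ, a ≤ s ∧ b ≤ t ∧ s + t = r := by
  constructor
  · intro h
    have hab : a + b ≠ ⊤ := (h.trans_lt (EReal.coe_lt_top r)).ne
    have ha' : a ≠ ⊤ := fun h' => hab (h' ▸ EReal.top_add_of_ne_bot hb.ne')
    lift a to ℝ using ⟨ha', ha.ne'⟩
    exact ⟨a, r - a, le_rfl, by rwa [EReal.coe_sub, EReal.le_sub_iff_add_le (by simp) (by simp),
      add_comm], add_sub_cancel a r⟩
  · rintro ⟨s, t, hs, ht, rfl⟩
    exact add_le_add hs ht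

end Epigraphs

section Costs

variable {n T τ t : ℕ} {L : ℕ → Vec n × Vec n → EReal} {g : Vec n → EReal} {x y : ℕ → Vec n}

/-- The dual Lagrangian `K_t` as a function of the costate `p_{t-1}` and of `Δp_t`, in place of
`p_t` and `Δp_t`: with this running cost the dual problem has the form of the primal one. -/
noncomputable def costateLagrangian (L : ℕ → Vec n × Vec n → EReal) (t : ℕ) (z : Vec n × Vec n) :
    EReal :=
  dualLagrangian L t (z.1 + z.2, z.2)

theorem dualCost_eq_primalCost (T : ℕ) (L : ℕ → Vec n × Vec n → EReal) (g : Vec n → EReal) (τ : ℕ)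
    (p : ℕ → Vec n) :
    dualCost T L g τ p = primalCost T (costateLagrangian L) (dualTerminal g) τ p := by
  simp only [dualCost, primalCost, costateLagrangian, add_sub_cancel]

theorem terminalDual_epi (g : Vec n → EReal) : terminalDual (epi g) = epi (dualTerminal g) :=
  Set.ext fun q => (iSup_coe_sub_le_coe_iff (fun x => inner ℝ x (-q.1)) g q.2).symm

theorem lagrangianDual_epi (L : ℕ → Vec n × Vec n → EReal) (t : ℕ) :
    lagrangianDual (epi (L t)) = epi (costateLagrangian L t) :=
  Set.ext fun q => (iSup_coe_sub_le_coe_iff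
    (fun z : Vec n × Vec n => inner ℝ z.1 q.1.2 + inner ℝ z.2 (q.1.1 + q.1.2)) (L t) q.2).symm

theorem primalCost_of_lt (hτ : τ < T) (x : ℕ → Vec n) :
    primalCost T L g τ x = L (τ + 1) (x τ, x (τ + 1) - x τ) + primalCost T L g (τ + 1) x := by
  rw [primalCost, primalCost, ← Finset.insert_Icc_add_one_left_eq_Icc (Nat.succ_le_of_lt hτ),
    Finset.sum_insert (by simp), add_assoc]
  rfl

theorem primalCost_congr (hτ : τ ≤ T) (hxy : ∀ t ∈ Finset.Icc τ T, x t = y t) :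
    primalCost T L g τ x = primalCost T L g τ y := by
  simp only [Finset.mem_Icc] at hxy
  rw [primalCost, primalCost, hxy T ⟨hτ, le_rfl⟩]
  congr 1
  refine Finset.sum_congr rfl fun t ht => ?_
  rw [Finset.mem_Icc] at ht
  rw [hxy t (by omega), hxy (t - 1) (by omega)]

theorem bot_lt_primalCost (hL : ∀ t ∈ Finset.Icc 1 T, ∀ z, ⊥ < L t z) (hg : ∀ ξ, ⊥ < g ξ)
    (hτ : τ ≤ T) (x : ℕ → Vec n) : ⊥ < primalCost T L g τ x := by
  induction hτ using Nat.decreasingInduction with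
  | self => simpa [primalCost] using hg _
  | of_succ k hk ih =>
    rw [primalCost_of_lt hk, EReal.bot_lt_add_iff]
    exact ⟨hL _ (Finset.mem_Icc.2 ⟨k.succ_pos, hk⟩) _, ih⟩

/-- The pairs of a state at time `τ` and an upper bound of the cost of some trajectory issued from
it. This set lies between the strict epigraph and the epigraph of `primalValue T L g τ`, and its
points remember that the bound is reached. -/
def costEpi (T : ℕ) (L : ℕ → Vec n × Vec n → EReal) (g : Vec n → EReal) (τ : ℕ) :
    Set (Vec n × ℝ) :=
  {q | ∃ x : ℕ → Vec n, x τ = q.1 ∧ primalCost T L g τ x ≤ q.2}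

theorem costEpi_final (T : ℕ) (L : ℕ → Vec n × Vec n → EReal) (g : Vec n → EReal) :
    costEpi T L g T = epi g := by
  have primalCost_final (x : ℕ → Vec n) : primalCost T L g T x = g (x T) := by simp [primalCost]
  ext ⟨ξ, r⟩
  simp only [costEpi, epi, Set.mem_ofPred_eq, primalCost_final]
  exact ⟨fun ⟨_, hx, hr⟩ => hx ▸ hr, fun hr => ⟨fun _ => ξ, rfl, hr⟩⟩

theorem costEpi_of_lt (hL : ∀ t ∈ Finset.Icc 1 T, ∀ z, ⊥ < L t z) (hg : ∀ ξ, ⊥ < g ξ)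
    (hτ : τ < T) :
    costEpi T L g τ = bellmanStep (epi (L (τ + 1))) (costEpi T L g (τ + 1)) := by
  have cost_le_iff (x : ℕ → Vec n) (r : ℝ) := add_le_coe_iff_exists (r := r)
    (hL (τ + 1) (Finset.mem_Icc.2 ⟨τ.succ_pos, hτ⟩) (x τ, x (τ + 1) - x τ))
    (bot_lt_primalCost hL hg hτ x)
  ext ⟨ξ, r⟩
  constructor
  · rintro ⟨x, rfl, hx⟩
    obtain ⟨s, t, hs, ht, hst⟩ := (cost_le_iff x r).1 (primalCost_of_lt hτ x ▸ hx)
    exact ⟨x (τ + 1) - x τ, s, t, hs, ⟨x, (add_sub_cancel _ _).symm, ht⟩, hst⟩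
  · rintro ⟨v, s, t, hs, ⟨x, hx : x (τ + 1) = ξ + v, ht⟩, hst⟩
    let x' := Function.update x τ ξ
    have x'_now : x' τ = ξ := Function.update_self ..
    have x'_later (t : ℕ) (ht : t ∈ Finset.Icc (τ + 1) T) : x' t = x t :=
      Function.update_of_ne (by rw [Finset.mem_Icc] at ht; omega) ..
    refine ⟨x', x'_now, ?_⟩
    rw [primalCost_of_lt hτ, cost_le_iff]
    refine ⟨s, t, ?_, (primalCost_congr hτ x'_later).trans_le ht, hst⟩
    rwa [x'_now, x'_later _ (Finset.left_mem_Icc.2 hτ), hx, add_sub_cancel_left]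

theorem convex_costEpi (hL : ∀ t ∈ Finset.Icc 1 T, ∀ z, ⊥ < L t z) (hg : ∀ ξ, ⊥ < g ξ)
    (hLc : ∀ t ∈ Finset.Icc 1 T, Convex ℝ (epi (L t))) (hgc : Convex ℝ (epi g)) (hτ : τ ≤ T) :
    Convex ℝ (costEpi T L g τ) := by
  induction hτ using Nat.decreasingInduction with
  | self => rwa [costEpi_final]
  | of_succ k hk ih =>
    rw [costEpi_of_lt hL hg hk]
    exact convex_bellmanStep (hLc _ (Finset.mem_Icc.2 ⟨k.succ_pos, hk⟩)) ih

theorem mem_relCore_image_fst_costEpi (hL : ∀ t ∈ Finset.Icc 1 T, ∀ z, ⊥ < L t z)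
    (hg : ∀ ξ, ⊥ < g ξ) (hxT : x T ∈ relCore (effDom g))
    (hx : ∀ t ∈ Finset.Icc 1 T, (x (t - 1), x t - x (t - 1)) ∈ relCore (effDom (L t)))
    (hτ : τ ≤ T) : x τ ∈ relCore (Prod.fst '' costEpi T L g τ) := by
  induction hτ using Nat.decreasingInduction with
  | self => rwa [costEpi_final, image_fst_epi]
  | of_succ k hk ih =>
    have running := hx (k + 1) (Finset.mem_Icc.2 ⟨k.succ_pos, hk⟩)
    rw [Nat.add_sub_cancel, ← image_fst_epi] at running
    rw [costEpi_of_lt hL hg hk]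
    exact mem_relCore_image_fst_bellmanStep running (by rwa [add_sub_cancel])

theorem terminalDual_costEpi (hL : ∀ t ∈ Finset.Icc 1 T, ∀ z, ⊥ < L t z) (hg : ∀ ξ, ⊥ < g ξ)
    (hLc : ∀ t ∈ Finset.Icc 1 T, Convex ℝ (epi (L t))) (hgc : Convex ℝ (epi g))
    (hxT : x T ∈ relCore (effDom g))
    (hx : ∀ t ∈ Finset.Icc 1 T, (x (t - 1), x t - x (t - 1)) ∈ relCore (effDom (L t)))
    (hτ : τ ≤ T) :
    terminalDual (costEpi T L g τ) = costEpi T (costateLagrangian L) (dualTerminal g) τ := by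
  have dual_running (t) (ht : t ∈ Finset.Icc 1 T) (q) : ⊥ < costateLagrangian L t q :=
    bot_lt_iSup_coe_sub ⟨_, (hx t ht).1⟩ _
  have dual_terminal (b) : ⊥ < dualTerminal g b := bot_lt_iSup_coe_sub ⟨_, hxT.1⟩ _
  induction hτ using Nat.decreasingInduction with
  | self => rw [costEpi_final, costEpi_final, terminalDual_epi]
  | of_succ k hk ih =>
    have hk' : k + 1 ∈ Finset.Icc 1 T := Finset.mem_Icc.2 ⟨k.succ_pos, hk⟩
    have running := hx (k + 1) hk'
    rw [Nat.add_sub_cancel, ← image_fst_epi] at running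
    have terminal := mem_relCore_image_fst_costEpi hL hg hxT hx hk
    rw [costEpi_of_lt hL hg hk, costEpi_of_lt dual_running dual_terminal hk, ← lagrangianDual_epi,
      ← ih]
    exact terminalDual_bellmanStep (hLc _ hk') (convex_costEpi hL hg hLc hgc hk) running
      (by rwa [add_sub_cancel])

theorem terminalDual_epi_primalValue (T : ℕ) (L : ℕ → Vec n × Vec n → EReal) (g : Vec n → EReal)
    (τ : ℕ) : terminalDual (epi (primalValue T L g τ)) = terminalDual (costEpi T L g τ) := by
  ext ⟨p, M⟩
  constructor
  · rintro h ⟨ξ, r⟩ ⟨x, hx, hr⟩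
    exact h (ξ, r) (show primalValue T L g τ ξ ≤ r from iInf₂_le_of_le x hx hr)
  · rintro h ⟨ξ, r⟩ (hr : primalValue T L g τ ξ ≤ r)
    refine le_of_forall_pos_le_add fun ε hε => ?_
    have strict : primalValue T L g τ ξ < (r + ε : ℝ) :=
      hr.trans_lt (EReal.coe_lt_coe_iff.2 (lt_add_of_pos_right r hε))
    obtain ⟨x, hx, hcost⟩ := by simpa only [primalValue, iInf_lt_iff, exists_prop] using strict
    have := h (ξ, r + ε) ⟨x, hx, hcost.le⟩
    linarith

theorem conjugate_primalValue_le_coe_iff (hL : ∀ t ∈ Finset.Icc 1 T, ∀ z, ⊥ < L t z)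
    (hg : ∀ ξ, ⊥ < g ξ) (hLc : ∀ t ∈ Finset.Icc 1 T, Convex ℝ (epi (L t)))
    (hgc : Convex ℝ (epi g)) (hxT : x T ∈ relCore (effDom g))
    (hx : ∀ t ∈ Finset.Icc 1 T, (x (t - 1), x t - x (t - 1)) ∈ relCore (effDom (L t)))
    (hτ : τ ≤ T) (η : Vec n) (M : ℝ) :
    conjugate (primalValue T L g τ) η ≤ M ↔
      ∃ p : ℕ → Vec n, p τ = -η ∧ dualCost T L g τ p ≤ M := by
  have dual_epi : epi (dualTerminal (primalValue T L g τ)) =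
      costEpi T (costateLagrangian L) (dualTerminal g) τ := by
    rw [← terminalDual_epi, terminalDual_epi_primalValue,
      terminalDual_costEpi hL hg hLc hgc hxT hx hτ]
  calc conjugate (primalValue T L g τ) η ≤ M
      ↔ (-η, M) ∈ epi (dualTerminal (primalValue T L g τ)) := by
        simp only [epi, dualTerminal, Set.mem_ofPred_eq, neg_neg]
    _ ↔ ∃ p : ℕ → Vec n, p τ = -η ∧ dualCost T L g τ p ≤ M := by
        simp only [dual_epi, costEpi, Set.mem_ofPred_eq, dualCost_eq_primalCost]

theorem dynamicsSet_eq (hL : ∀ z, ⊥ < L t z) (ξ : Vec n) :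
    dynamicsSet L t ξ = {v | (ξ, v) ∈ effDom (L t)} := by
  ext v
  constructor
  · rintro ⟨r, hr⟩
    exact hr.trans_lt (EReal.coe_lt_top r)
  · intro hv
    exact ⟨_, (EReal.coe_toReal (ne_of_lt hv) (hL _).ne').symm⟩

theorem stateSet_eq (hL : ∀ z, ⊥ < L t z) : stateSet L t = Prod.fst '' effDom (L t) := by
  ext ξ
  simp only [stateSet, dynamicsSet_eq hL, Set.mem_ofPred_eq, Set.Nonempty, Set.mem_image,
    Prod.exists, exists_and_right, exists_eq_right]

theorem mem_relCore_effDom_of_mem_intrinsicInterior (hL : ∀ z, ⊥ < L t z)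
    (hLc : Convex ℝ (epi (L t))) {ξ v : Vec n} (hξ : ξ ∈ intrinsicInterior ℝ (stateSet L t))
    (hv : v ∈ intrinsicInterior ℝ (dynamicsSet L t ξ)) : (ξ, v) ∈ relCore (effDom (L t)) := by
  have hdom : Convex ℝ (effDom (L t)) :=
    image_fst_epi (L t) ▸ hLc.linear_image (LinearMap.fst ℝ _ _)
  rw [stateSet_eq hL] at hξ
  rw [dynamicsSet_eq hL] at hv
  exact prodMk_mem_relCore hdom (intrinsicInterior_subset_relCore _ hξ)
    (intrinsicInterior_subset_relCore _ hv)

end Costs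

end Bolza

open Bolza in
theorem mainTheorem2_general {n : ℕ} (T : ℕ) (L : ℕ → Vec n × Vec n → EReal) (g : Vec n → EReal)
    (hL : ∀ t ∈ Finset.Icc 1 T, ∀ z, ⊥ < L t z) (hg : ∀ ξ, ⊥ < g ξ)
    (hLc : ∀ t ∈ Finset.Icc 1 T, Convex ℝ (epi (L t))) (hgc : Convex ℝ (epi g))
    (hH : PrimalStrictlyFeasible T L g) (τ : ℕ) (hτ : τ ≤ T) :
    conjugate (primalValue T L g τ) = dualValue T L g τ ∧
    ∀ η ∈ effDom (dualValue T L g τ),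
      ∃ p : ℕ → Vec n, p τ = -η ∧ dualCost T L g τ p = dualValue T L g τ η := by
  obtain ⟨x, hxT, hx⟩ := hH
  replace hxT := intrinsicInterior_subset_relCore _ hxT
  have hx' (t) (ht : t ∈ Finset.Icc 1 T) := mem_relCore_effDom_of_mem_intrinsicInterior
    (hL t ht) (hLc t ht) (hx t ht).1 (hx t ht).2
  have conj_le_iff := conjugate_primalValue_le_coe_iff hL hg hLc hgc hxT hx' hτ
  have duality : conjugate (primalValue T L g τ) = dualValue T L g τ := by
    funext η
    apply le_antisymm
    · exact le_iInf₂ fun p hp => EReal.le_of_forall_lt_iff_le.1 fun M hM =>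
        (conj_le_iff η M).2 ⟨p, hp, hM.le⟩
    · refine EReal.le_of_forall_lt_iff_le.1 fun M hM => ?_
      obtain ⟨p, hp, hcost⟩ := (conj_le_iff η M).1 hM.le
      exact iInf₂_le_of_le p hp hcost
  refine ⟨duality, fun η hη => ?_⟩
  obtain ⟨⟨⟨ξ, r⟩, ⟨y, hy, hr⟩, -⟩, -⟩ := mem_relCore_image_fst_costEpi hL hg hxT hx' hτ
  have value_dom : (effDom (primalValue T L g τ)).Nonempty :=
    ⟨ξ, (iInf₂_le_of_le y hy hr).trans_lt (EReal.coe_lt_top r)⟩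
  have value_real := EReal.coe_toReal (ne_of_lt hη)
    (duality ▸ (bot_lt_iSup_coe_sub value_dom _).ne' : dualValue T L g τ η ≠ ⊥)
  obtain ⟨p, hp, hcost⟩ := (conj_le_iff η _).1 ((congrFun duality η).trans value_real.symm).le
  exact ⟨p, hp, le_antisymm (hcost.trans value_real.le) (iInf₂_le p hp)⟩

theorem mainTheorem2 {n : ℕ} (T : ℕ) (L : ℕ → Bolza.Vec n × Bolza.Vec n → EReal)
    (g : Bolza.Vec n → EReal)
    (hL : ∀ t ∈ Finset.Icc 1 T, Bolza.IsProperConvexLsc (L t))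
    (hg : Bolza.IsProperConvexLsc g)
    (hH : Bolza.PrimalStrictlyFeasible T L g)
    (τ : ℕ) (hτ : τ ≤ T) :
    Bolza.conjugate (Bolza.primalValue T L g τ) = Bolza.dualValue T L g τ ∧
    ∀ η ∈ Bolza.effDom (Bolza.dualValue T L g τ),
      ∃ p : ℕ → Bolza.Vec n, p τ = -η ∧
        Bolza.dualCost T L g τ p = Bolza.dualValue T L g τ η :=
  mainTheorem2_general T L g (fun t ht => (hL t ht).proper.2) hg.proper.2
    (fun t ht => (hL t ht).convex) hg.convex hH τ hτ
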